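/- Let $\mathbb{H}_{\mathbb{R}}=M_2(\mathbb{R})$ be the algebra of split quaternions and let $\mathbb{H}_{\mathbb{R}}\mathbb{P}^1$ be the set of pairs $(X,Y)\in\mathbb{H}_{\mathbb{R}}^2$ for which no nonzero $A\in\mathbb{H}_{\mathbb{R}}$ satisfies $XA=YA=0$, modulo $(X,Y)\sim(Xq,Yq)$ for $q\in GL(2,\mathbb{R})$; sending $[X:Y]$ to the plane in $\mathbb{R}^4$ spanned by the columns of $\begin{pmatrix}X\\Y\end{pmatrix}$ identifies it, as a smooth manifold, with the Grassmannian of 2-planes in $\mathbb{R}^4$. The group $SL(4,\mathbb{R})$ acts on it by $$\begin{pmatrix}a&b\\c&d\end{pmatrix}\cdot[X:Y]=[aX+bY:cX+dY],\qquad a,b,c,d\in\mathbb{H}_{\mathbb{R}}.$$ The basic split anti-instanton is the pair $(\mathcal{P},\nabla)$, where $\mathcal{P}\subset\mathbb{H}_{\mathbb{R}}\mathbb{P}^1\times\mathbb{R}^4$ is the universal rank-2 bundle, whose fibre at $[X:Y]$ is the plane above with the inner product induced from the standard one of $\mathbb{R}^4$, and $\nabla$ is the orthogonal projection to $\mathcal{P}$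 of the trivial connection on $\mathbb{R}^4$. An element $g\in SL(4,\mathbb{R})$ acts on it by pull-back: $g^*\mathcal{P}$ is the bundle with fibre $\mathcal{P}_{g\cdot p}$ at $p$, with the projection of the trivial connection. We say that $g$ leaves the basic split anti-instanton invariant up to gauge transformation if there is a smooth bundle isomorphism $\mathcal{P}\to g^*\mathcal{P}$ over the identity of $\mathbb{H}_{\mathbb{R}}\mathbb{P}^1$ that is orthogonal on each fibre and carries the connection $\nabla$ to $g^*\nabla$. Then the set of all $g\in SL(4,\mathbb{R})$ that leave the basic split anti-instanton invariant up to gauge transformation is exactly the subgroup $SO(4)$. -/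

import Mathlib

open Matrix
open scoped Manifold ContDiff

/-- Square matrices of size two: the algebra of split quaternions. -/
abbrev SplitQuat : Type := Matrix (Fin 2) (Fin 2) ℝ

/-- The normed space of the four coordinates `x i j` of a split quaternion. -/
abbrev SplitCoord : Type := Fin 2 → Fin 2 → ℝ

/-- The special linear group `SL(4, ℝ)`. The four coordinates are indexed by `Fin 2 ⊕ Fin 2`, so
that an element is a two by two block matrix of split quaternions. -/
abbrev SL4 : Type := Matrix.SpecialLinearGroup (Fin 2 ⊕ Fin 2) ℝ

/-- The standard Euclidean space `ℝ⁴`, with coordinates indexed as for `SL4`. -/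
abbrev E4 : Type := EuclideanSpace ℝ (Fin 2 ⊕ Fin 2)

/-- Nondegenerate pairs `(X, Y)` of split quaternions: no nonzero `A` satisfies `X A = Y A = 0`.
A pair is written as the four by two matrix with upper block `X` and lower block `Y`. -/
abbrev NondegPair : Type :=
  {u : Matrix (Fin 2 ⊕ Fin 2) (Fin 2) ℝ // ∀ A : SplitQuat, u * A = 0 → A = 0}

namespace NondegPair

/-- Pairs are identified when they differ by right multiplication by an invertible split
quaternion. -/
instance setoid : Setoid NondegPair where
  r u v := ∃ q : GL (Fin 2) ℝ, v.1 = u.1 * (q : SplitQuat)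
  iseqv :=
    { refl := fun u => ⟨1, by simp⟩
      symm := by
        rintro u v ⟨q, h⟩
        refine ⟨q⁻¹, ?_⟩
        rw [h, Matrix.mul_assoc, ← Units.val_mul, mul_inv_cancel, Units.val_one, Matrix.mul_one]
      trans := by
        rintro u v w ⟨q, h⟩ ⟨r, k⟩
        exact ⟨q * r, by rw [k, h, Units.val_mul, Matrix.mul_assoc]⟩ }

theorem inv_mul_mul (g : SL4) {m : Type} (u : Matrix (Fin 2 ⊕ Fin 2) m ℝ) :
    (g⁻¹ : SL4).1 * (g.1 * u) = u := by
  rw [← Matrix.mul_assoc, ← Matrix.SpecialLinearGroup.coe_mul, inv_mul_cancel,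
    Matrix.SpecialLinearGroup.coe_one, Matrix.one_mul]

theorem mul_mul (g h : SL4) {m : Type} (u : Matrix (Fin 2 ⊕ Fin 2) m ℝ) :
    (g * h : SL4).1 * u = g.1 * (h.1 * u) := by
  rw [← Matrix.mul_assoc]; rfl

theorem mul_inv_mul (g : SL4) {m : Type} (u : Matrix (Fin 2 ⊕ Fin 2) m ℝ) :
    g.1 * ((g⁻¹ : SL4).1 * u) = u := by
  simpa using inv_mul_mul g⁻¹ u

/-- Left multiplication of a pair by a matrix of `SL(4, ℝ)`. -/
def act (g : SL4) (u : NondegPair) : NondegPair :=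
  ⟨g.1 * u.1, fun A h => u.2 A (by
    rw [← inv_mul_mul g (u.1 * A), ← Matrix.mul_assoc g.1, h, Matrix.mul_zero])⟩

/-- The pair `(X, 1)`. -/
def ofAffine (X : SplitQuat) : NondegPair :=
  ⟨Matrix.fromRows X 1, fun A h => by
    rw [Matrix.fromRows_mul] at h
    have h2 := congrArg Matrix.toRows₂ h
    rw [Matrix.toRows₂_fromRows, Matrix.one_mul] at h2
    exact h2⟩

end NondegPair

/-- The split quaternionic projective line, with the quotient topology. -/
def HRP1 : Type := Quotient NondegPair.setoid

namespace HRP1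

instance : TopologicalSpace HRP1 := instTopologicalSpaceQuotient

/-- The class `[X : Y]` of a nondegenerate pair. -/
def mk (u : NondegPair) : HRP1 := Quotient.mk _ u

/-- The action of `SL(4, ℝ)`: the matrix with blocks `a, b, c, d` maps `[X : Y]` to
`[a X + b Y : c X + d Y]`. -/
instance : MulAction SL4 HRP1 where
  smul g := Quotient.map (NondegPair.act g) (by
    rintro u v ⟨q, h⟩
    exact ⟨q, by simp only [NondegPair.act, h, Matrix.mul_assoc]⟩)
  one_smul p := by
    induction p using Quotient.inductionOn with
    | _ u => exact congrArg mk (Subtype.ext (Matrix.one_mul u.1))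
  mul_smul g h p := by
    induction p using Quotient.inductionOn with
    | _ u =>
      exact congrArg mk (Subtype.ext (by
        simp only [NondegPair.act, Matrix.SpecialLinearGroup.coe_mul, Matrix.mul_assoc]))

/-! The smooth structure. For `g` in `SL(4, ℝ)` the chart at `g` is the inverse of the map
`X ↦ g • [X : 1]`. -/

/-- The coordinate of a pair in the chart at `g`: if the pair is `g (X, Y)`, this is `X Y⁻¹`. -/
noncomputable def preCoord (g : SL4) (u : NondegPair) : SplitQuat :=
  ((g⁻¹ : SL4).1 * u.1).toRows₁ * (((g⁻¹ : SL4).1 * u.1).toRows₂)⁻¹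

/-- The determinant of the lower block of `g⁻¹ u`. -/
noncomputable def preDet (g : SL4) (u : NondegPair) : ℝ :=
  (((g⁻¹ : SL4).1 * u.1).toRows₂).det

theorem toRows₁_mul' {m : Type} (u : Matrix (Fin 2 ⊕ Fin 2) (Fin 2) ℝ)
    (q : Matrix (Fin 2) m ℝ) : (u * q).toRows₁ = u.toRows₁ * q := rfl

theorem toRows₂_mul' {m : Type} (u : Matrix (Fin 2 ⊕ Fin 2) (Fin 2) ℝ)
    (q : Matrix (Fin 2) m ℝ) : (u * q).toRows₂ = u.toRows₂ * q := rfl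

theorem continuous_preDet (g : SL4) : Continuous (preDet g) := by
  have h : Continuous fun u : NondegPair => (g⁻¹ : SL4).1 * u.1 :=
    continuous_const.matrix_mul continuous_subtype_val
  have h2 : Continuous fun u : NondegPair => ((g⁻¹ : SL4).1 * u.1).toRows₂ :=
    continuous_matrix fun i j => h.matrix_elem (Sum.inr i) j
  exact h2.matrix_det

theorem continuousOn_preCoord (g : SL4) : ContinuousOn (preCoord g) {u | preDet g u ≠ 0} := by
  have h : Continuous fun u : NondegPair => (g⁻¹ : SL4).1 * u.1 :=
    continuous_const.matrix_mul continuous_subtype_val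
  have h1 : Continuous fun u : NondegPair => ((g⁻¹ : SL4).1 * u.1).toRows₁ :=
    continuous_matrix fun i j => h.matrix_elem (Sum.inl i) j
  have h2 : Continuous fun u : NondegPair => ((g⁻¹ : SL4).1 * u.1).toRows₂ :=
    continuous_matrix fun i j => h.matrix_elem (Sum.inr i) j
  have e : preCoord g = fun u => (preDet g u)⁻¹ •
      (((g⁻¹ : SL4).1 * u.1).toRows₁ * (((g⁻¹ : SL4).1 * u.1).toRows₂).adjugate) := by
    funext u
    simp [preCoord, preDet, Matrix.inv_def]
  rw [e]
  exact ((continuous_preDet g).continuousOn.inv₀ fun u hu => hu).smul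
    (h1.matrix_mul h2.matrix_adjugate).continuousOn

/-- The coordinate of a point in the chart at `g`. -/
noncomputable def coord (g : SL4) : HRP1 → SplitQuat :=
  Quotient.lift (preCoord g) (by
    rintro u v ⟨q, h⟩
    have hq : (q : SplitQuat) * (q : SplitQuat)⁻¹ = 1 :=
      Matrix.mul_nonsing_inv _ ((Matrix.isUnit_iff_isUnit_det _).1 q.isUnit)
    simp only [preCoord, h, ← Matrix.mul_assoc, toRows₁_mul', toRows₂_mul', Matrix.mul_inv_rev]
    rw [Matrix.mul_assoc _ (q : SplitQuat), hq, Matrix.mul_one])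

/-- The domain of the chart at `g`. -/
def dom (g : SL4) : Set HRP1 :=
  {p | Quotient.lift (fun u => preDet g u ≠ 0) (by
    rintro u v ⟨q, h⟩
    have hq : (q : SplitQuat).det ≠ 0 :=
      ((Matrix.isUnit_iff_isUnit_det _).1 q.isUnit).ne_zero
    simp [preDet, h, ← Matrix.mul_assoc, toRows₂_mul', hq]) p}

/-- The point `g • [X : 1]`. -/
def param (g : SL4) (X : SplitQuat) : HRP1 := g • mk (NondegPair.ofAffine X)

theorem preDet_ofAffine (g h : SL4) (X : SplitQuat) :
    preDet h (NondegPair.act g (NondegPair.ofAffine X)) =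
      (((h⁻¹ * g : SL4).1 * Matrix.fromRows X (1 : SplitQuat)).toRows₂).det := by
  rw [NondegPair.mul_mul]; rfl

theorem preCoord_ofAffine (g h : SL4) (X : SplitQuat) :
    preCoord h (NondegPair.act g (NondegPair.ofAffine X)) =
      ((h⁻¹ * g : SL4).1 * Matrix.fromRows X (1 : SplitQuat)).toRows₁ *
        (((h⁻¹ * g : SL4).1 * Matrix.fromRows X (1 : SplitQuat)).toRows₂)⁻¹ := by
  rw [NondegPair.mul_mul]; rfl

theorem param_mem_dom (g : SL4) (X : SplitQuat) : param g X ∈ dom g := by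
  change preDet g (NondegPair.act g (NondegPair.ofAffine X)) ≠ 0
  rw [preDet_ofAffine, inv_mul_cancel, Matrix.SpecialLinearGroup.coe_one, Matrix.one_mul,
    Matrix.toRows₂_fromRows, Matrix.det_one]
  exact one_ne_zero

theorem coord_param (g : SL4) (X : SplitQuat) : coord g (param g X) = X := by
  change preCoord g (NondegPair.act g (NondegPair.ofAffine X)) = X
  rw [preCoord_ofAffine, inv_mul_cancel, Matrix.SpecialLinearGroup.coe_one, Matrix.one_mul,
    Matrix.toRows₂_fromRows, Matrix.toRows₁_fromRows, inv_one, Matrix.mul_one]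

theorem param_coord (g : SL4) {p : HRP1} (hp : p ∈ dom g) : param g (coord g p) = p := by
  induction p using Quotient.inductionOn with
  | _ u =>
    change preDet g u ≠ 0 at hp
    have hu : IsUnit (((g⁻¹ : SL4).1 * u.1).toRows₂).det := isUnit_iff_ne_zero.2 hp
    refine Quotient.sound ⟨Matrix.nonsingInvUnit _ hu, ?_⟩
    change u.1 = g.1 * Matrix.fromRows (preCoord g u) (1 : SplitQuat) *
      ((g⁻¹ : SL4).1 * u.1).toRows₂
    rw [Matrix.mul_assoc, Matrix.fromRows_mul, preCoord, Matrix.mul_assoc,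
      Matrix.nonsing_inv_mul _ hu, Matrix.mul_one, Matrix.one_mul, Matrix.fromRows_toRows,
      NondegPair.mul_inv_mul]

theorem continuous_param (g : SL4) : Continuous (param g) := by
  have h : Continuous fun X : SplitQuat => NondegPair.act g (NondegPair.ofAffine X) := by
    refine Continuous.subtype_mk (continuous_const.matrix_mul ?_) _
    refine continuous_matrix fun i j => ?_
    rcases i with i | i
    · exact continuous_id.matrix_elem i j
    · exact continuous_const
  exact continuous_quot_mk.comp h

theorem isOpen_dom (g : SL4) : IsOpen (dom g) :=
  isQuotientMap_quot_mk.isOpen_preimage.1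
    (isOpen_ne.preimage (continuous_preDet g) : IsOpen {u | preDet g u ≠ 0})

theorem continuousOn_coord (g : SL4) : ContinuousOn (coord g) (dom g) :=
  (isQuotientMap_quot_mk.continuousOn_isOpen_iff (isOpen_dom g)).2 (continuousOn_preCoord g)

/-- The chart at `g`, inverse to `X ↦ g • [X : 1]`. -/
noncomputable def chart (g : SL4) : OpenPartialHomeomorph HRP1 SplitCoord where
  toFun p := Matrix.of.symm (coord g p)
  invFun x := param g (Matrix.of x)
  source := dom g
  target := Set.univ
  map_source' _ _ := Set.mem_univ _
  map_target' x _ := param_mem_dom g (Matrix.of x)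
  left_inv' _ hp := param_coord g hp
  right_inv' x _ := coord_param g (Matrix.of x)
  open_source := isOpen_dom g
  open_target := isOpen_univ
  continuousOn_toFun := continuousOn_coord g
  continuousOn_invFun := (continuous_param g).continuousOn

theorem exists_mem_dom (p : HRP1) : ∃ g : SL4, p ∈ dom g := by
  induction p using Quotient.inductionOn with
  | _ u =>
    have hli : LinearIndependent ℝ u.1.col := by
      rw [← Matrix.mulVec_injective_iff, ← Matrix.coe_mulVecLin, injective_iff_map_eq_zero]
      intro v hv
      have h0 := u.2 (Matrix.of fun i _ => v i) (by
        ext i j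
        exact congrFun hv i)
      funext i
      exact congrFun (congrFun h0 i) 0
    let b0 := Module.Basis.sumExtend hli
    have : Fintype (Module.Basis.sumExtendIndex hli) := by
      have := Module.Finite.finite_basis b0
      have : Finite (Module.Basis.sumExtendIndex hli) :=
        Finite.of_injective (Sum.inr : _ → Fin 2 ⊕ Module.Basis.sumExtendIndex hli)
          Sum.inr_injective
      exact Fintype.ofFinite _
    have hcard : Fintype.card (Module.Basis.sumExtendIndex hli) = Fintype.card (Fin 2) := by
      have h1 := Module.finrank_eq_card_basis b0
      simp at h1
      simp
      omega
    let e := Fintype.equivOfCardEq hcard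
    let b := b0.reindex ((Equiv.sumComm _ _).trans (Equiv.sumCongr e (Equiv.refl (Fin 2))))
    have hb : ∀ j, b (Sum.inr j) = u.1.col j := by
      intro j
      simp only [b, b0, Module.Basis.sumExtend, Module.Basis.reindex_apply]
      simp
      rfl
    let G : Matrix (Fin 2 ⊕ Fin 2) (Fin 2 ⊕ Fin 2) ℝ := Matrix.of fun i j => b j i
    have hG : G.det ≠ 0 := by
      have h1 : (Pi.basisFun ℝ (Fin 2 ⊕ Fin 2)).toMatrix b = G := by
        ext i j
        simp [G, Module.Basis.toMatrix_apply]
      have h2 := (Pi.basisFun ℝ (Fin 2 ⊕ Fin 2)).isUnit_det b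
      rw [Module.Basis.det_apply, h1] at h2
      exact h2.ne_zero
    let D : Matrix (Fin 2 ⊕ Fin 2) (Fin 2 ⊕ Fin 2) ℝ :=
      Matrix.fromBlocks !![(G.det)⁻¹, 0; 0, 1] 0 0 1
    let g : SL4 := ⟨G * D, by
      rw [Matrix.det_mul, Matrix.det_fromBlocks_zero₂₁]
      simp [hG]⟩
    have hD : D * Matrix.fromRows (0 : SplitQuat) (1 : SplitQuat) =
        Matrix.fromRows (0 : SplitQuat) (1 : SplitQuat) := by
      simp [D, Matrix.fromBlocks_mul_fromRows]
    have hg : u.1 = g.1 * Matrix.fromRows (0 : SplitQuat) (1 : SplitQuat) := by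
      change u.1 = G * D * _
      rw [Matrix.mul_assoc, hD]
      ext i j
      simp [Matrix.mul_apply, G, hb, Matrix.one_apply]
    refine ⟨g, ?_⟩
    change (((g⁻¹ : SL4).1 * u.1).toRows₂).det ≠ 0
    rw [hg, NondegPair.inv_mul_mul, Matrix.toRows₂_fromRows, Matrix.det_one]
    exact one_ne_zero

noncomputable instance : ChartedSpace SplitCoord HRP1 where
  atlas := Set.range chart
  chartAt p := chart (exists_mem_dom p).choose
  mem_chart_source p := (exists_mem_dom p).choose_spec
  chart_mem_atlas _ := Set.mem_range_self _

instance : IsManifold 𝓘(ℝ, SplitCoord) ∞ HRP1 := by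
  refine isManifold_of_contDiffOn _ _ _ ?_
  rintro _ _ ⟨g, rfl⟩ ⟨h, rfl⟩
  have hrow : ∀ (k : Matrix (Fin 2 ⊕ Fin 2) (Fin 2 ⊕ Fin 2) ℝ) (i : Fin 2 ⊕ Fin 2) (j : Fin 2),
      ContDiff ℝ ∞ fun x : SplitCoord =>
        (k * Matrix.fromRows (Matrix.of x) (1 : SplitQuat)) i j := by
    intro k i j
    simp only [Matrix.mul_apply, Fintype.sum_sum_type, Matrix.fromRows_apply_inl,
      Matrix.fromRows_apply_inr, Matrix.of_apply]
    fun_prop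
  have hdet : ∀ k : Matrix (Fin 2 ⊕ Fin 2) (Fin 2 ⊕ Fin 2) ℝ, ContDiff ℝ ∞ fun x : SplitCoord =>
      ((k * Matrix.fromRows (Matrix.of x) (1 : SplitQuat)).toRows₂).det := by
    intro k
    simp only [Matrix.det_fin_two, Matrix.toRows₂_apply]
    exact ((hrow k _ _).mul (hrow k _ _)).sub ((hrow k _ _).mul (hrow k _ _))
  have hadj : ∀ (k : Matrix (Fin 2 ⊕ Fin 2) (Fin 2 ⊕ Fin 2) ℝ) (i j : Fin 2),
      ContDiff ℝ ∞ fun x : SplitCoord =>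
      ((k * Matrix.fromRows (Matrix.of x) (1 : SplitQuat)).toRows₂).adjugate i j := by
    intro k i j
    simp only [Matrix.adjugate_fin_two]
    fin_cases i <;> fin_cases j <;> simp <;>
      first | exact hrow k _ _ | exact (hrow k _ _).neg
  have key : ContDiffOn ℝ ∞ (fun x : SplitCoord => Matrix.of.symm (coord h (param g (Matrix.of x))))
      {x | (((h⁻¹ * g : SL4).1 * Matrix.fromRows (Matrix.of x) (1 : SplitQuat)).toRows₂).det ≠ 0} := by
    refine contDiffOn_pi.2 fun i => contDiffOn_pi.2 fun j => ?_
    have e : ∀ x : SplitCoord, Matrix.of.symm (coord h (param g (Matrix.of x))) i j =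
        ∑ l, ((h⁻¹ * g : SL4).1 * Matrix.fromRows (Matrix.of x) (1 : SplitQuat)) (Sum.inl i) l *
        ((((h⁻¹ * g : SL4).1 * Matrix.fromRows (Matrix.of x) (1 : SplitQuat)).toRows₂).det⁻¹ *
        (((h⁻¹ * g : SL4).1 * Matrix.fromRows (Matrix.of x) (1 : SplitQuat)).toRows₂).adjugate
          l j) := by
      intro x
      change preCoord h (NondegPair.act g (NondegPair.ofAffine (Matrix.of x))) i j = _
      rw [preCoord_ofAffine, Matrix.mul_apply, Matrix.inv_def, Ring.inverse_eq_inv']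
      rfl
    simp only [e]
    refine ContDiffOn.sum fun l _ => ?_
    exact (hrow _ _ _).contDiffOn.mul (((hdet _).contDiffOn.inv fun x hx => hx).mul
      (hadj _ _ _).contDiffOn)
  refine key.mono ?_
  rintro x ⟨hx, -⟩
  have hx' : param g (Matrix.of x) ∈ dom h := hx.2
  change preDet h (NondegPair.act g (NondegPair.ofAffine (Matrix.of x))) ≠ 0 at hx'
  rwa [preDet_ofAffine] at hx'

theorem contMDiff_smul (g : SL4) :
    ContMDiff 𝓘(ℝ, SplitCoord) 𝓘(ℝ, SplitCoord) ∞ fun p : HRP1 => g • p := by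
  intro p
  obtain ⟨h, hp⟩ := exists_mem_dom p
  have h1 : ContMDiffOn 𝓘(ℝ, SplitCoord) 𝓘(ℝ, SplitCoord) ∞ (chart h) (dom h) :=
    contMDiffOn_of_mem_maximalAtlas
      (IsManifold.subset_maximalAtlas (Set.mem_range_self h : chart h ∈ Set.range chart))
  have h2 : ContMDiffOn 𝓘(ℝ, SplitCoord) 𝓘(ℝ, SplitCoord) ∞ (chart (g * h)).symm Set.univ :=
    contMDiffOn_symm_of_mem_maximalAtlas (IsManifold.subset_maximalAtlas
      (Set.mem_range_self (g * h) : chart (g * h) ∈ Set.range chart))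
  refine ((h2.comp h1 fun _ _ => Set.mem_univ _).congr fun q hq => ?_).contMDiffAt
    ((isOpen_dom h).mem_nhds hp)
  change g • q = param (g * h) (coord h q)
  rw [param, mul_smul]
  exact congrArg (g • ·) (param_coord h hq).symm

end HRP1

/-! Vector bundles with connection inside the trivial bundle `HRP1 × ℝ⁴`. A family `E` of subspaces
of `ℝ⁴` carries the inner products induced from `ℝ⁴`. -/

namespace Subbundle

/-- Smoothness of a section. -/
def IsSmooth {E : HRP1 → Submodule ℝ E4} (s : ∀ p, E p) : Prop :=
  ContMDiff 𝓘(ℝ, SplitCoord) 𝓘(ℝ, E4) ∞ fun p => (s p : E4)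

/-- The projection to `E` of the trivial connection: the covariant derivative at `p` of the section
`s` along the tangent vector `v` is the orthogonal projection to `E p` of the derivative of `s`,
as a function with values in `ℝ⁴`, along `v`. -/
noncomputable def conn {E : HRP1 → Submodule ℝ E4} (s : ∀ p, E p) (p : HRP1)
    (v : TangentSpace 𝓘(ℝ, SplitCoord) p) : E p :=
  (E p).orthogonalProjectionOnto (mfderiv 𝓘(ℝ, SplitCoord) 𝓘(ℝ, E4) (fun q => (s q : E4)) p v)

/-- The pull-back of `E` under the action of `g`. The projected connection on it is the pull-back of
the projected connection on `E`, by `conn_pullback`. -/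
def pullback (g : SL4) (E : HRP1 → Submodule ℝ E4) : HRP1 → Submodule ℝ E4 := fun p => E (g • p)

/-- The pull-back of a section. -/
def pullbackSection (g : SL4) {E : HRP1 → Submodule ℝ E4} (s : ∀ p, E p) :
    ∀ p, pullback g E p := fun p => s (g • p)

theorem conn_pullback (g : SL4) {E : HRP1 → Submodule ℝ E4} (s : ∀ p, E p) (hs : IsSmooth s)
    (p : HRP1) (v : TangentSpace 𝓘(ℝ, SplitCoord) p) :
    conn (pullbackSection g s) p v =
      conn s (g • p) (mfderiv 𝓘(ℝ, SplitCoord) 𝓘(ℝ, SplitCoord) (fun q : HRP1 => g • q) p v) := by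
  have h1 := (hs (g • p)).mdifferentiableAt (by simp)
  have h2 := (HRP1.contMDiff_smul g p).mdifferentiableAt (by simp)
  have h3 := mfderiv_comp p h1 h2
  change (E (g • p)).orthogonalProjectionOnto (mfderiv 𝓘(ℝ, SplitCoord) 𝓘(ℝ, E4)
    ((fun q => (s q : E4)) ∘ fun q : HRP1 => g • q) p v) = _
  rw [h3]
  rfl

/-- A smooth isomorphism from `E` to `E'` over the identity, orthogonal on each fibre. Smoothness is
that of the operator on `ℝ⁴` which is the isomorphism on `E p` and zero on its complement. -/
structure Iso (E E' : HRP1 → Submodule ℝ E4) where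
  /-- The map of fibres. -/
  fibre : ∀ p, E p ≃ₗᵢ[ℝ] E' p
  smooth : ContMDiff 𝓘(ℝ, SplitCoord) 𝓘(ℝ, E4 →L[ℝ] E4) ∞ fun p =>
    (E' p).subtypeL ∘L ((fibre p).toContinuousLinearEquiv : E p →L[ℝ] E' p) ∘L
      (E p).orthogonalProjectionOnto

/-- Gauge equivalence of `E` and `E'` with their projected connections: some orthogonal isomorphism
`Φ` satisfies `∇' (Φ s) = Φ (∇ s)` for all smooth sections `s`. -/
def GaugeEquivalent (E E' : HRP1 → Submodule ℝ E4) : Prop :=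
  ∃ Φ : Iso E E', ∀ s : ∀ p, E p, IsSmooth s →
    ∀ (p : HRP1) (v : TangentSpace 𝓘(ℝ, SplitCoord) p),
      conn (fun q => Φ.fibre q (s q)) p v = Φ.fibre p (conn s p v)

end Subbundle

/-- The universal bundle, whose projected connection is the basic split anti-instanton. Its fibre
at `[X : Y]` is the column space in `ℝ⁴` of the four by two matrix with blocks `X`, `Y`. -/
noncomputable def universalBundle : HRP1 → Submodule ℝ E4 :=
  Quotient.lift (fun u : NondegPair => LinearMap.range (Matrix.toEuclideanLin u.1)) (by
    have key : ∀ u v : NondegPair, u ≈ v →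
        LinearMap.range (Matrix.toEuclideanLin v.1) ≤ LinearMap.range (Matrix.toEuclideanLin u.1) := by
      rintro u v ⟨q, h⟩
      rw [h, Matrix.toEuclideanLin, Matrix.toLpLin_mul (q := 2)]
      exact LinearMap.range_comp_le_range _ _
    exact fun u v h => le_antisymm (key v u (Setoid.symm h)) (key u v h))

/-- The action of `g` on the basic split anti-instanton gives a gauge equivalent connection. -/
def FixesBasicAntiInstanton (g : SL4) : Prop :=
  Subbundle.GaugeEquivalent universalBundle (Subbundle.pullback g universalBundle)

/-! An orthogonal `g` gives a constant isometry of `ℝ⁴` carrying the plane at `p` to the plane at `g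
• p`. It commutes with derivatives and intertwines the orthogonal projections, so it is a gauge
equivalence.

Conversely, compare curvatures. Let `P` and `Q` be the projections to the universal bundle and to
its pull-back, and extend a gauge equivalence by zero to an operator `A` on `ℝ⁴`. Preservation of
the connection gives `Q dA = A dP`. With `Q A = A` this becomes `dA = dQ A + A dP`, and symmetry of
the second derivative of `A` shows that `A` intertwines the commutators of `dP` and `dQ`
(`commutator_fderiv_mul_eq`).

At the centre of the chart at an orthogonal `k`, write `k = (N₀ M₀)` and `g k = (N M)` in pairs of
columns. The commutators then reduce to `(aᵀ D b - bᵀ D a) h = Mᵀ M h (aᵀ b - bᵀ a)`, with `h` the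
invertible matrix of `A` in the bases `M₀`, `M`, and `D` the Schur complement of `Mᵀ M` in the Gram
matrix of `g k` (`exists_curvature_eq`). Varying `a` and `b` forces `D = δ • 1` and `δ ^ 2 = det (Mᵀ
M)`. The Gram matrix has determinant one, so `δ ^ 4 = 1`; as `D` is itself a Gram matrix, `δ ≥ 0`
and `δ = 1` (`schur_eq_one`).

Thus the upper left block of `((g k)ᵀ (g k))⁻¹` is the identity. Letting `k` run over even
permutation matrices reads off every entry of `(gᵀ g)⁻¹`, which is therefore the identity. -/

/-! ### Curvature identity for intertwined families -/

/-- If `A` intertwines two families `P`, `Q` to first order, in the sense that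
`dA = dQ A + A dP`, then it intertwines the commutators of their derivatives. -/
theorem commutator_fderiv_mul_eq {V R : Type*} [NormedAddCommGroup V] [NormedSpace ℝ V]
    [NormedRing R] [NormedAlgebra ℝ R] {A P Q : V → R} (hA : ContDiff ℝ 2 A)
    (hP : ContDiff ℝ 2 P) (hQ : ContDiff ℝ 2 Q)
    (h : ∀ x v, fderiv ℝ A x v = fderiv ℝ Q x v * A x + A x * fderiv ℝ P x v) (x a b : V) :
    (fderiv ℝ Q x b * fderiv ℝ Q x a - fderiv ℝ Q x a * fderiv ℝ Q x b) * A x =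
      A x * (fderiv ℝ P x b * fderiv ℝ P x a - fderiv ℝ P x a * fderiv ℝ P x b) := by
  have hd : ∀ {f : V → R}, ContDiff ℝ 2 f → ∀ v, HasFDerivAt (fun y => fderiv ℝ f y v)
      ((fderiv ℝ (fderiv ℝ f) x).flip v) x := fun {f} hf v => by
    have h1 : ContDiff ℝ 1 (fderiv ℝ f) := hf.fderiv_right (by norm_num)
    have h2 := ((h1.differentiable one_ne_zero) x).hasFDerivAt.clm_apply
      (hasFDerivAt_const v x)
    simpa using h2
  have hs : ∀ {f : V → R}, ContDiff ℝ 2 f → ∀ v w,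
      fderiv ℝ (fderiv ℝ f) x v w = fderiv ℝ (fderiv ℝ f) x w v := fun {f} hf v w =>
    (hf.contDiffAt.isSymmSndFDerivAt (by simp)) v w
  have hA1 := ((hA.differentiable two_ne_zero) x).hasFDerivAt
  have key : ∀ v w, fderiv ℝ (fderiv ℝ A) x w v =
      fderiv ℝ Q x v * fderiv ℝ A x w + fderiv ℝ (fderiv ℝ Q) x w v * A x +
      (A x * fderiv ℝ (fderiv ℝ P) x w v + fderiv ℝ A x w * fderiv ℝ P x v) := by
    intro v w
    have h1 := hd hA v
    have h2 := ((hd hQ v).mul' hA1).add (hA1.mul' (hd hP v))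
    have h3 : (fun y => fderiv ℝ A y v) =
      ((fun y => fderiv ℝ Q y v) * A + A * fun y => fderiv ℝ P y v) := funext fun y => h y v
    rw [← h3] at h2
    simpa using congrArg (fun L => L w) (h1.unique h2)
  -- Once `dA` is replaced by `dQ A + A dP`, the mixed terms `dQ A dP` are symmetric in `a`, `b` and
  -- cancel, as do the second derivatives; only the commutators remain.
  have e := (key a b).symm.trans ((hs hA b a).trans (key b a))
  rw [h x a, h x b, hs hQ b a, hs hP b a] at e
  have e2 := sub_eq_zero.2 e
  refine sub_eq_zero.1 ((Eq.trans ?_ (neg_eq_zero.2 e2)))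
  noncomm_ring

/-! ### Orthogonal projections to column spaces -/

namespace Matrix

/-- The matrix of the orthogonal projection to the column space of `u`, for `u` with independent
columns. -/
noncomputable def colProj {m n : Type*} [Fintype m] [Fintype n] [DecidableEq n]
    (u : Matrix m n ℝ) : Matrix m m ℝ :=
  u * (uᵀ * u)⁻¹ * uᵀ

variable {m n : Type*} [Fintype m] [Fintype n] [DecidableEq n] {u : Matrix m n ℝ}

theorem colProj_mul_self (hu : (uᵀ * u).det ≠ 0) : colProj u * u = u := by
  rw [colProj, Matrix.mul_assoc, Matrix.mul_assoc,
    Matrix.nonsing_inv_mul _ (isUnit_iff_ne_zero.2 hu), Matrix.mul_one]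

theorem transpose_mul_colProj (hu : (uᵀ * u).det ≠ 0) : uᵀ * colProj u = uᵀ := by
  rw [colProj, ← Matrix.mul_assoc, ← Matrix.mul_assoc,
    Matrix.mul_nonsing_inv _ (isUnit_iff_ne_zero.2 hu), Matrix.one_mul]

theorem colProj_transpose : (colProj u)ᵀ = colProj u := by
  simp [colProj, Matrix.transpose_nonsing_inv, Matrix.mul_assoc]

variable [DecidableEq m]

theorem one_sub_colProj_mul_self (hu : (uᵀ * u).det ≠ 0) :
    (1 - colProj u) * (1 - colProj u) = 1 - colProj u := by
  have h : colProj u * colProj u = colProj u := by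
    nth_rewrite 1 [colProj]
    rw [Matrix.mul_assoc, transpose_mul_colProj hu, colProj]
  rw [Matrix.sub_mul, Matrix.one_mul, Matrix.mul_sub, Matrix.mul_one, h, sub_self, sub_zero]

theorem toEuclideanCLM_colProj (hu : (uᵀ * u).det ≠ 0) :
    toEuclideanCLM (n := m) (𝕜 := ℝ) (colProj u) =
      (LinearMap.range (toEuclideanLin u)).starProjection := by
  ext1 w
  symm
  refine Submodule.eq_starProjection_of_mem_of_inner_eq_zero
    (K := LinearMap.range (toEuclideanLin u)) ?_ ?_
  · refine ⟨WithLp.toLp 2 (((uᵀ * u)⁻¹ * uᵀ) *ᵥ w.ofLp), ?_⟩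
    apply WithLp.ofLp_injective
    simp [colProj, Matrix.mul_assoc]
  · rintro _ ⟨v, rfl⟩
    have : uᵀ *ᵥ (w - toEuclideanCLM (n := m) (𝕜 := ℝ) (colProj u) w).ofLp = 0 := by
      simp [Matrix.mulVec_sub, transpose_mul_colProj hu]
    rw [EuclideanSpace.inner_eq_star_dotProduct]
    simp only [star_trivial, ofLp_toLpLin, toLin'_apply]
    rw [dotProduct_comm, dotProduct_mulVec, ← mulVec_transpose]
    rw [this]
    simp

end Matrix

theorem NondegPair.det_transpose_mul_self_ne_zero (u : NondegPair) : (u.1ᵀ * u.1).det ≠ 0 := by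
  intro h
  obtain ⟨v, hv, h0⟩ := Matrix.exists_mulVec_eq_zero_iff.2 h
  have h1 : u.1 *ᵥ v = 0 := by
    rw [← Matrix.conjTranspose_eq_transpose_of_trivial] at h0
    exact (Matrix.conjTranspose_mul_self_mulVec_eq_zero _ _).1 h0
  have h2 := u.2 (Matrix.of fun i _ => v i) (by ext i j; exact congrFun h1 i)
  exact hv (funext fun i => congrFun (congrFun h2 i) 0)

/-! ### Schur complements and the curvature relation -/

namespace Matrix

/-- If `h` is invertible and `(aᵀ D b - bᵀ D a) h = C h (aᵀ b - bᵀ a)` for all `a`, `b`, then `D` is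
a scalar matrix and its determinant is that of `C`. -/
theorem eq_smul_one_of_skew_eq {D C h : Matrix (Fin 2) (Fin 2) ℝ} (hh : h.det ≠ 0)
    (e : ∀ a b : Matrix (Fin 2) (Fin 2) ℝ,
      (aᵀ * D * b - bᵀ * D * a) * h = C * h * (aᵀ * b - bᵀ * a)) :
    ∃ δ : ℝ, D = δ • (1 : Matrix (Fin 2) (Fin 2) ℝ) ∧ δ ^ 2 = C.det := by
  have hu : h * h⁻¹ = 1 := Matrix.mul_nonsing_inv _ (isUnit_iff_ne_zero.2 hh)
  have e' : ∀ a b : Matrix (Fin 2) (Fin 2) ℝ,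
      aᵀ * D * b - bᵀ * D * a = C * h * (aᵀ * b - bᵀ * a) * h⁻¹ := by
    intro a b
    rw [← e, Matrix.mul_assoc (_ - _), hu, Matrix.mul_one]
  -- The first two pairs have `aᵀ b - bᵀ a = 0`, which kills the off-diagonal entries of `D`. The
  -- last two have the same nonzero `aᵀ b - bᵀ a`, which equates its diagonal entries.
  have h01 := e' !![1, 0; 0, 0] !![0, 0; 0, 1]
  have h10 := e' !![0, 0; 1, 0] !![0, 1; 0, 0]
  have h00 := e' !![1, 0; 0, 0] !![0, 1; 0, 0]
  have h11 := e' !![0, 0; 1, 0] !![0, 0; 0, 1]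
  have k : ∀ {X Y : Matrix (Fin 2) (Fin 2) ℝ}, X = Y → X 0 1 = Y 0 1 := fun h => by rw [h]
  have z : !![1, 0; 0, 0]ᵀ * !![0, 0; 0, 1] - !![0, 0; 0, 1]ᵀ * !![1, 0; 0, 0] =
    (0 : Matrix (Fin 2) (Fin 2) ℝ) := by
    ext i j; fin_cases i <;> fin_cases j <;> simp [Matrix.mul_apply]
  have z' : !![0, 0; 1, 0]ᵀ * !![0, 1; 0, 0] - !![0, 1; 0, 0]ᵀ * !![0, 0; 1, 0] =
    (0 : Matrix (Fin 2) (Fin 2) ℝ) := by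
    ext i j; fin_cases i <;> fin_cases j <;> simp [Matrix.mul_apply]
  have j0 : !![1, 0; 0, 0]ᵀ * !![0, 1; 0, 0] - !![0, 1; 0, 0]ᵀ * !![1, 0; 0, 0] =
    (!![0, 1; -1, 0] : Matrix (Fin 2) (Fin 2) ℝ) := by
    ext i j; fin_cases i <;> fin_cases j <;> simp [Matrix.mul_apply]
  have j1 : !![0, 0; 1, 0]ᵀ * !![0, 0; 0, 1] - !![0, 0; 0, 1]ᵀ * !![0, 0; 1, 0] =
    (!![0, 1; -1, 0] : Matrix (Fin 2) (Fin 2) ℝ) := by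
    ext i j; fin_cases i <;> fin_cases j <;> simp [Matrix.mul_apply]
  rw [z, Matrix.mul_zero, Matrix.zero_mul] at h01
  rw [z', Matrix.mul_zero, Matrix.zero_mul] at h10
  rw [j0] at h00
  rw [j1, ← h00] at h11
  have d01 : D 0 1 = 0 := by simpa [Matrix.mul_apply, Fin.sum_univ_two] using k h01
  have d10 : D 1 0 = 0 := by simpa [Matrix.mul_apply, Fin.sum_univ_two] using k h10
  have d11 : D 1 1 = D 0 0 := by simpa [Matrix.mul_apply, Fin.sum_univ_two] using k h11
  have hD : D = D 0 0 • (1 : Matrix (Fin 2) (Fin 2) ℝ) := by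
    ext i j; fin_cases i <;> fin_cases j <;> simp [d01, d10, d11]
  refine ⟨D 0 0, hD, ?_⟩
  have := congrArg Matrix.det (e !![1, 0; 0, 0] !![0, 1; 0, 0])
  rw [j0, hD, Matrix.det_mul, Matrix.det_mul, Matrix.det_mul] at this
  have hJ : (!![1, 0; 0, 0]ᵀ * D 0 0 • (1 : Matrix (Fin 2) (Fin 2) ℝ) * !![0, 1; 0, 0] -
      !![0, 1; 0, 0]ᵀ * D 0 0 • (1 : Matrix (Fin 2) (Fin 2) ℝ) * !![1, 0; 0, 0]).det =
      D 0 0 ^ 2 := by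
    simp [Matrix.det_fin_two, Matrix.mul_apply, sq]
  rw [hJ] at this
  refine mul_right_cancel₀ hh (this.trans ?_)
  simp [Matrix.det_fin_two]

/-- If the Gram matrix of the columns of `N` and `M` has determinant one and the Schur complement of
`Mᵀ M` in it satisfies the curvature relation of `eq_smul_one_of_skew_eq` with `C = Mᵀ M`, then the
Schur complement is the identity. -/
theorem schur_eq_one {N M : Matrix (Fin 2 ⊕ Fin 2) (Fin 2) ℝ} (hM : (Mᵀ * M).det ≠ 0)
    (hdet : ((fromCols N M)ᵀ * fromCols N M).det = 1) {h : Matrix (Fin 2) (Fin 2) ℝ}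
    (hh : h.det ≠ 0)
    (e : ∀ a b : Matrix (Fin 2) (Fin 2) ℝ,
      (aᵀ * (Nᵀ * (1 - colProj M) * N) * b - bᵀ * (Nᵀ * (1 - colProj M) * N) * a) * h =
        Mᵀ * M * h * (aᵀ * b - bᵀ * a)) :
    Nᵀ * (1 - colProj M) * N = 1 := by
  obtain ⟨δ, hD, hδ⟩ := eq_smul_one_of_skew_eq hh e
  have hs : Nᵀ * (1 - colProj M) * N =
      Nᵀ * N - Nᵀ * M * (Mᵀ * M)⁻¹ * (Mᵀ * N) := by
    simp only [colProj, Matrix.mul_sub, Matrix.sub_mul, Matrix.mul_one, Matrix.mul_assoc]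
  have hpos : 0 ≤ δ := by
    -- As `1 - colProj M` is a symmetric idempotent, the Schur complement is the Gram matrix of the
    -- projected columns of `N`.
    have h1 : Nᵀ * (1 - colProj M) * N = ((1 - colProj M) * N)ᴴ * ((1 - colProj M) * N) := by
      rw [conjTranspose_eq_transpose_of_trivial, transpose_mul, transpose_sub, colProj_transpose,
        transpose_one, Matrix.mul_assoc, Matrix.mul_assoc, ← Matrix.mul_assoc (1 - colProj M),
        one_sub_colProj_mul_self hM]
    have h2 := (posSemidef_conjTranspose_mul_self ((1 - colProj M) * N)).diag_nonneg (i := 0)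
    rw [← h1, hD] at h2
    simpa using h2
  have hG : (fromCols N M)ᵀ * fromCols N M =
      fromBlocks (Nᵀ * N) (Nᵀ * M) (Mᵀ * N) (Mᵀ * M) := by
    rw [transpose_fromCols, fromRows_mul_fromCols]
  have : Invertible (Mᵀ * M) := invertibleOfIsUnitDet _ (isUnit_iff_ne_zero.2 hM)
  rw [hG, det_fromBlocks₂₂, invOf_eq_nonsing_inv, ← hs, hD, ← hδ] at hdet
  have h4 : δ ^ 4 = 1 := by
    rw [← hdet]; simp; ring
  have : δ = 1 := (pow_eq_one_iff_of_nonneg hpos (by norm_num)).1 h4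
  rw [hD, this, one_smul]

/-- If the Schur complement is the identity, then so is the upper left block of the inverse of the
Gram matrix. -/
theorem gram_inv_toBlocks₁₁ {N M : Matrix (Fin 2 ⊕ Fin 2) (Fin 2) ℝ} (hM : (Mᵀ * M).det ≠ 0)
    (hdet : ((fromCols N M)ᵀ * fromCols N M).det = 1)
    (h1 : Nᵀ * (1 - colProj M) * N = 1) :
    (((fromCols N M)ᵀ * fromCols N M)⁻¹).toBlocks₁₁ = 1 := by
  have hs : Nᵀ * (1 - colProj M) * N =
      Nᵀ * N - Nᵀ * (M * ((Mᵀ * M)⁻¹ * (Mᵀ * N))) := by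
    simp only [colProj, Matrix.mul_sub, Matrix.sub_mul, Matrix.mul_one, Matrix.mul_assoc]
  have hG : (fromCols N M)ᵀ * fromCols N M =
      fromBlocks (Nᵀ * N) (Nᵀ * M) (Mᵀ * N) (Mᵀ * M) := by
    rw [transpose_fromCols, fromRows_mul_fromCols]
  -- Block elimination: this block column is the first block column of the inverse Gram matrix.
  have h2 : ((fromCols N M)ᵀ * fromCols N M) *
      fromRows (1 : Matrix (Fin 2) (Fin 2) ℝ) (-((Mᵀ * M)⁻¹ * (Mᵀ * N))) =
      fromRows (1 : Matrix (Fin 2) (Fin 2) ℝ) (0 : Matrix (Fin 2) (Fin 2) ℝ) := by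
    rw [hG, fromBlocks_mul_fromRows]
    congr 1
    · rw [Matrix.mul_one, ← h1, hs, Matrix.mul_neg, Matrix.mul_assoc, sub_eq_add_neg]
    · rw [Matrix.mul_one, Matrix.mul_neg, ← Matrix.mul_assoc (Mᵀ * M),
        Matrix.mul_nonsing_inv _ (isUnit_iff_ne_zero.2 hM), Matrix.one_mul, add_neg_cancel]
  have h3 := congrArg (fun X => ((fromCols N M)ᵀ * fromCols N M)⁻¹ * X) h2
  simp only [← Matrix.mul_assoc] at h3
  rw [Matrix.mul_assoc _ (fromCols N M)ᵀ, Matrix.nonsing_inv_mul _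
    (by rw [hdet]; exact isUnit_one), Matrix.one_mul] at h3
  rw [← fromBlocks_toBlocks ((fromCols N M)ᵀ * fromCols N M)⁻¹, fromBlocks_mul_fromRows] at h3
  simpa using (congrArg toRows₁ h3).symm

end Matrix

/-! ### Smoothness of matrix-valued maps -/

theorem contDiff_toEuclideanCLM {V n : Type*} [NormedAddCommGroup V] [NormedSpace ℝ V]
    [Fintype n] [DecidableEq n] {k : WithTop ℕ∞} {F : V → Matrix n n ℝ}
    (hF : ∀ i j, ContDiff ℝ k fun x => F x i j) :
    ContDiff ℝ k fun x => toEuclideanCLM (n := n) (𝕜 := ℝ) (F x) := by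
  have e : ∀ x, toEuclideanCLM (n := n) (𝕜 := ℝ) (F x) =
      ∑ i, ∑ j, F x i j • toEuclideanCLM (n := n) (𝕜 := ℝ) (Matrix.single i j 1) := by
    intro x
    conv_lhs => rw [Matrix.matrix_eq_sum_single (F x)]
    simp only [map_sum, ← map_smul, Matrix.smul_single, smul_eq_mul, mul_one]
  simp only [e]
  exact ContDiff.sum fun i _ => ContDiff.sum fun j _ => (hF i j).smul contDiff_const

theorem contDiff_matrix_mul_apply {V l m n : Type*} [NormedAddCommGroup V] [NormedSpace ℝ V]
    [Fintype m] {k : WithTop ℕ∞} {F : V → Matrix l m ℝ} {G : V → Matrix m n ℝ}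
    (hF : ∀ i j, ContDiff ℝ k fun x => F x i j) (hG : ∀ i j, ContDiff ℝ k fun x => G x i j)
    (i : l) (j : n) : ContDiff ℝ k fun x => (F x * G x) i j := by
  simp only [Matrix.mul_apply]
  exact ContDiff.sum fun r _ => (hF i r).mul (hG r j)

theorem contDiff_colProj_apply {V m : Type*} [NormedAddCommGroup V] [NormedSpace ℝ V]
    [Fintype m] {k : WithTop ℕ∞} {u : V → Matrix m (Fin 2) ℝ}
    (hu : ∀ i j, ContDiff ℝ k fun x => u x i j) (hdet : ∀ x, ((u x)ᵀ * u x).det ≠ 0) (i j : m) :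
    ContDiff ℝ k fun x => colProj (u x) i j := by
  have ht : ∀ i j, ContDiff ℝ k fun x => (u x)ᵀ i j := fun i j => hu j i
  have hc := fun i j => contDiff_matrix_mul_apply ht hu i j
  have hd : ContDiff ℝ k fun x => ((u x)ᵀ * u x).det := by
    simp only [Matrix.det_fin_two]
    exact ((hc _ _).mul (hc _ _)).sub ((hc _ _).mul (hc _ _))
  have ha : ∀ i j, ContDiff ℝ k fun x => ((u x)ᵀ * u x).adjugate i j := by
    intro i j
    simp only [Matrix.adjugate_fin_two]
    fin_cases i <;> fin_cases j
    · exact hc 1 1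
    · exact (hc 0 1).neg
    · exact (hc 1 0).neg
    · exact hc 0 0
  have hi : ∀ i j, ContDiff ℝ k fun x => ((u x)ᵀ * u x)⁻¹ i j := by
    intro i j
    simp only [Matrix.inv_def, Ring.inverse_eq_inv', Matrix.smul_apply, smul_eq_mul]
    exact (hd.inv hdet).mul (ha i j)
  exact contDiff_matrix_mul_apply (fun i j => contDiff_matrix_mul_apply hu hi i j) ht i j

/-! ### Smoothness and derivatives in the charts -/

namespace HRP1

/-- A map on the projective line is smooth if it is smooth in all charts. -/
theorem contMDiff_of_contDiff_param {F : Type*} [NormedAddCommGroup F] [NormedSpace ℝ F]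
    {f : HRP1 → F} (hf : ∀ h, ContDiff ℝ ∞ fun x : SplitCoord => f (param h (Matrix.of x))) :
    ContMDiff 𝓘(ℝ, SplitCoord) 𝓘(ℝ, F) ∞ f := by
  intro p
  obtain ⟨h, hp⟩ := exists_mem_dom p
  have h1 : ContMDiffOn 𝓘(ℝ, SplitCoord) 𝓘(ℝ, SplitCoord) ∞ (chart h) (dom h) :=
    contMDiffOn_of_mem_maximalAtlas
      (IsManifold.subset_maximalAtlas (Set.mem_range_self h : chart h ∈ Set.range chart))
  refine (((hf h).contMDiff.comp_contMDiffOn h1).congr fun q hq => ?_).contMDiffAt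
    ((isOpen_dom h).mem_nhds hp)
  exact congrArg f (param_coord h hq).symm

theorem contMDiff_param (h : SL4) :
    ContMDiff 𝓘(ℝ, SplitCoord) 𝓘(ℝ, SplitCoord) ∞
      fun x : SplitCoord => param h (Matrix.of x) :=
  contMDiffOn_univ.1 (contMDiffOn_symm_of_mem_maximalAtlas (IsManifold.subset_maximalAtlas
    (Set.mem_range_self h : chart h ∈ Set.range chart)))

theorem contDiff_comp_param {F : Type*} [NormedAddCommGroup F] [NormedSpace ℝ F]
    {f : HRP1 → F} (hf : ContMDiff 𝓘(ℝ, SplitCoord) 𝓘(ℝ, F) ∞ f) (h : SL4) :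
    ContDiff ℝ ∞ fun x : SplitCoord => f (param h (Matrix.of x)) :=
  (hf.comp (contMDiff_param h)).contDiff

theorem mfderiv_param {F : Type*} [NormedAddCommGroup F] [NormedSpace ℝ F]
    {f : HRP1 → F} (hf : ContMDiff 𝓘(ℝ, SplitCoord) 𝓘(ℝ, F) ∞ f) (h : SL4) (x a : SplitCoord) :
    fderiv ℝ (fun x : SplitCoord => f (param h (Matrix.of x))) x a =
      mfderiv 𝓘(ℝ, SplitCoord) 𝓘(ℝ, F) f (param h (Matrix.of x))
        (mfderiv 𝓘(ℝ, SplitCoord) 𝓘(ℝ, SplitCoord)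
          (fun x : SplitCoord => param h (Matrix.of x)) x a) := by
  rw [← mfderiv_eq_fderiv]
  have := mfderiv_comp x ((hf (param h (Matrix.of x))).mdifferentiableAt (by simp))
    ((contMDiff_param h x).mdifferentiableAt (by simp))
  exact congrArg (fun L => L a) this

theorem smul_param (g h : SL4) (X : SplitQuat) : g • param h X = param (g * h) X :=
  (mul_smul g h _).symm

end HRP1

/-! ### The projection to the universal bundle and its derivative -/

/-- The orthogonal projection to the fibre of the universal bundle. -/
noncomputable def universalProj (p : HRP1) : E4 →L[ℝ] E4 := (universalBundle p).starProjection

open HRP1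

theorem det_frame_ne_zero (h : SL4) (X : SplitQuat) :
    ((h.1 * Matrix.fromRows X (1 : SplitQuat))ᵀ *
      (h.1 * Matrix.fromRows X (1 : SplitQuat))).det ≠ 0 :=
  (NondegPair.act h (NondegPair.ofAffine X)).det_transpose_mul_self_ne_zero

theorem universalProj_param (h : SL4) (X : SplitQuat) :
    universalProj (param h X) = toEuclideanCLM (n := Fin 2 ⊕ Fin 2) (𝕜 := ℝ)
      (colProj (h.1 * Matrix.fromRows X (1 : SplitQuat))) := by
  rw [toEuclideanCLM_colProj (det_frame_ne_zero h X)]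
  rfl

theorem contMDiff_universalProj :
    ContMDiff 𝓘(ℝ, SplitCoord) 𝓘(ℝ, E4 →L[ℝ] E4) ∞ universalProj := by
  refine contMDiff_of_contDiff_param fun h => ?_
  simp only [universalProj_param]
  have hx : ∀ i j, ContDiff ℝ ∞ fun x : SplitCoord =>
      Matrix.fromRows (Matrix.of x) (1 : SplitQuat) i j := by
    rintro (i | i) j
    · simp only [Matrix.fromRows_apply_inl, Matrix.of_apply]
      fun_prop
    · exact contDiff_const
  have hc : ∀ i j, ContDiff ℝ ∞ fun _ : SplitCoord => h.1 i j := fun _ _ => contDiff_const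
  exact contDiff_toEuclideanCLM (contDiff_colProj_apply
    (fun i j => contDiff_matrix_mul_apply hc hx i j) fun x => det_frame_ne_zero h _)

/-- The matrix of the derivative at the centre of the chart at `h` of the projection to the
universal bundle. -/
noncomputable def derivProj (h : SL4) (a : SplitCoord) :
    Matrix (Fin 2 ⊕ Fin 2) (Fin 2 ⊕ Fin 2) ℝ :=
  (toEuclideanCLM (n := Fin 2 ⊕ Fin 2) (𝕜 := ℝ)).symm
    (fderiv ℝ (fun x : SplitCoord => universalProj (param h (Matrix.of x))) 0 a)

/-- Orthogonal projections are self-adjoint, hence so are their derivatives. -/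
theorem derivProj_transpose (h : SL4) (a : SplitCoord) : (derivProj h a)ᵀ = derivProj h a := by
  have h1 : HasFDerivAt (fun x : SplitCoord => universalProj (param h (Matrix.of x))) _ 0 :=
    (((contDiff_comp_param contMDiff_universalProj h).differentiable (by simp)) 0).hasFDerivAt
  have h2 := h1.star
  have e : (fun x : SplitCoord => star (universalProj (param h (Matrix.of x)))) =
      fun x : SplitCoord => universalProj (param h (Matrix.of x)) := by
    funext x
    rw [universalProj_param, ← map_star, Matrix.star_eq_conjTranspose,
      Matrix.conjTranspose_eq_transpose_of_trivial, colProj_transpose]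
  rw [e] at h2
  have h3 := congrArg (fun L => L a) (h2.unique h1)
  rw [derivProj]
  conv_rhs => rw [← h3]
  apply EquivLike.injective (toEuclideanCLM (n := Fin 2 ⊕ Fin 2) (𝕜 := ℝ))
  rw [← Matrix.conjTranspose_eq_transpose_of_trivial, ← Matrix.star_eq_conjTranspose, map_star,
    StarAlgEquiv.apply_symm_apply, StarAlgEquiv.apply_symm_apply]
  rfl

/-- Differentiating `P W = W` for the moving frame `W` gives `dP W = (1 - P) dW`. -/
theorem derivProj_mul (h : SL4) (a : SplitCoord) :
    derivProj h a * (h.1 * Matrix.fromRows (0 : SplitQuat) (1 : SplitQuat)) =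
      (1 - colProj (h.1 * Matrix.fromRows (0 : SplitQuat) (1 : SplitQuat))) *
        (h.1 * Matrix.fromRows (Matrix.of a) (0 : SplitQuat)) := by
  -- The frame `h (X, 1)` is padded with two zero columns to a square matrix, so that the product
  -- rule applies in the algebra of operators. It is affine in `X`, with linear part `L` and
  -- constant part `c`.
  let L : SplitCoord →ₗ[ℝ] (E4 →L[ℝ] E4) :=
    { toFun := fun x => toEuclideanCLM (n := Fin 2 ⊕ Fin 2) (𝕜 := ℝ)
        (h.1 * Matrix.fromBlocks 0 (Matrix.of x) 0 0)
      map_add' := fun x y => by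
        rw [← map_add, ← Matrix.mul_add, Matrix.fromBlocks_add]
        simp
      map_smul' := fun c x => by
        rw [← map_smul, ← Matrix.mul_smul, Matrix.fromBlocks_smul]
        simp }
  let c : E4 →L[ℝ] E4 := toEuclideanCLM (n := Fin 2 ⊕ Fin 2) (𝕜 := ℝ)
    (h.1 * Matrix.fromBlocks 0 0 0 1)
  have hLc : ∀ x, L x + c = toEuclideanCLM (n := Fin 2 ⊕ Fin 2) (𝕜 := ℝ)
      (h.1 * Matrix.fromBlocks 0 (Matrix.of x) 0 1) := by
    intro x
    simp only [L, c, LinearMap.coe_mk, AddHom.coe_mk]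
    rw [← map_add, ← Matrix.mul_add, Matrix.fromBlocks_add]
    simp
  have hcols : ∀ X : SplitQuat, Matrix.fromBlocks 0 X 0 (1 : SplitQuat) =
      Matrix.fromCols (0 : Matrix (Fin 2 ⊕ Fin 2) (Fin 2) ℝ) (Matrix.fromRows X 1) := by
    intro X
    ext (i | i) (j | j) <;> rfl
  have hW : HasFDerivAt (fun x => L.toContinuousLinearMap x + c) L.toContinuousLinearMap
      (0 : SplitCoord) := L.toContinuousLinearMap.hasFDerivAt.add_const c
  have hP : HasFDerivAt (fun x : SplitCoord => universalProj (param h (Matrix.of x))) _ 0 :=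
    (((contDiff_comp_param contMDiff_universalProj h).differentiable (by simp)) 0).hasFDerivAt
  have hPW := hP.mul' hW
  have e : ((fun x : SplitCoord => universalProj (param h (Matrix.of x))) *
      fun x => L.toContinuousLinearMap x + c) = fun x => L.toContinuousLinearMap x + c := by
    funext x
    change universalProj (param h (Matrix.of x)) * (L x + c) = L x + c
    rw [hLc, universalProj_param, ← map_mul, hcols, Matrix.mul_fromCols, Matrix.mul_fromCols,
      colProj_mul_self (det_frame_ne_zero h _)]
    simp
  rw [e] at hPW
  have h3 : universalProj (param h (Matrix.of 0)) * L a +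
      fderiv ℝ (fun x : SplitCoord => universalProj (param h (Matrix.of x))) 0 a * (L 0 + c) =
      L a := congrArg (fun T => T a) (hPW.unique hW)
  have h4 := congrArg (toEuclideanCLM (n := Fin 2 ⊕ Fin 2) (𝕜 := ℝ)).symm h3
  rw [hLc, universalProj_param] at h4
  simp only [map_add, map_mul, StarAlgEquiv.symm_apply_apply, L, LinearMap.coe_mk,
    AddHom.coe_mk] at h4
  have h5 := congrArg (fun T => T * Matrix.fromRows (0 : SplitQuat) (1 : SplitQuat)) h4
  have z : (Matrix.of (0 : SplitCoord)) = (0 : SplitQuat) := rfl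
  simp only [Matrix.add_mul, Matrix.mul_assoc, Matrix.fromBlocks_mul_fromRows, Matrix.mul_zero,
    Matrix.mul_one, add_zero, zero_add, z] at h5
  rw [Matrix.sub_mul, Matrix.one_mul]
  exact eq_sub_of_add_eq' h5

/-! ### Curvatures compared in frames -/

namespace Matrix

/-- The relation between the curvatures `aᵀ b - bᵀ a` and `aᵀ (Nᵀ (1 - Q) N) b - ...` of two
families of projections intertwined by an isometry `A`. -/
theorem exists_curvature_eq {N₀ M₀ N M : Matrix (Fin 2 ⊕ Fin 2) (Fin 2) ℝ}
    {A : Matrix (Fin 2 ⊕ Fin 2) (Fin 2 ⊕ Fin 2) ℝ}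
    {P Q : SplitCoord → Matrix (Fin 2 ⊕ Fin 2) (Fin 2 ⊕ Fin 2) ℝ}
    (hMM : M₀ᵀ * M₀ = 1) (hMN : M₀ᵀ * N₀ = 0) (hNN : N₀ᵀ * N₀ = 1)
    (hM : (Mᵀ * M).det ≠ 0) (hA : A * colProj M₀ = A) (hA' : colProj M * A = A)
    (hAA : Aᵀ * A = colProj M₀)
    (hPt : ∀ a, (P a)ᵀ = P a) (hQt : ∀ a, (Q a)ᵀ = Q a)
    (hP : ∀ a, P a * M₀ = (1 - colProj M₀) * (N₀ * Matrix.of a))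
    (hQ : ∀ a, Q a * M = (1 - colProj M) * (N * Matrix.of a))
    (hcomm : ∀ a b, (Q b * Q a - Q a * Q b) * A = A * (P b * P a - P a * P b)) :
    ∃ h : Matrix (Fin 2) (Fin 2) ℝ, h.det ≠ 0 ∧ ∀ a b : Matrix (Fin 2) (Fin 2) ℝ,
      (aᵀ * (Nᵀ * (1 - colProj M) * N) * b - bᵀ * (Nᵀ * (1 - colProj M) * N) * a) * h =
        Mᵀ * M * h * (aᵀ * b - bᵀ * a) := by
  have hproj : colProj M₀ = M₀ * M₀ᵀ := by
    rw [colProj, hMM, inv_one, Matrix.mul_one]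
  -- The columns of `A M₀` lie in the column space of `M`; the second factor is the matrix of `A` in
  -- the bases `M₀` and `M`.
  have hAM : A * M₀ = M * ((Mᵀ * M)⁻¹ * Mᵀ * A * M₀) := by
    conv_lhs => rw [← hA']
    simp only [colProj, Matrix.mul_assoc]
  set h := (Mᵀ * M)⁻¹ * Mᵀ * A * M₀ with hh
  clear_value h
  have hP' : ∀ a, P a * M₀ = N₀ * Matrix.of a := by
    intro a
    rw [hP, hproj, Matrix.sub_mul, Matrix.one_mul, Matrix.mul_assoc, ← Matrix.mul_assoc M₀ᵀ, hMN,
      Matrix.zero_mul, Matrix.mul_zero, sub_zero]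
  have hPP : ∀ a b, A * (P b * P a) * M₀ = M * h * ((Matrix.of b)ᵀ * Matrix.of a) := by
    intro a b
    have h1 : M₀ᵀ * P b = (Matrix.of b)ᵀ * N₀ᵀ := by
      rw [← Matrix.transpose_mul, ← hP', Matrix.transpose_mul, hPt]
    calc A * (P b * P a) * M₀ = A * P b * (P a * M₀) := by simp only [Matrix.mul_assoc]
      _ = A * colProj M₀ * P b * (N₀ * Matrix.of a) := by rw [hA, hP']
      _ = A * M₀ * (M₀ᵀ * P b) * (N₀ * Matrix.of a) := by
        rw [hproj]; simp only [Matrix.mul_assoc]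
      _ = M * h * (Matrix.of b)ᵀ * (N₀ᵀ * N₀) * Matrix.of a := by
        rw [h1, hAM]; simp only [Matrix.mul_assoc]
      _ = _ := by rw [hNN]; simp only [Matrix.mul_assoc, Matrix.one_mul]
  have hQQ : ∀ a b, Mᵀ * (Q b * Q a) * (A * M₀) =
      (Matrix.of b)ᵀ * (Nᵀ * (1 - colProj M) * N) * Matrix.of a * h := by
    intro a b
    have h1 : Mᵀ * Q b = (Matrix.of b)ᵀ * Nᵀ * (1 - colProj M) := by
      rw [← hQt, ← Matrix.transpose_mul, hQ, Matrix.transpose_mul, Matrix.transpose_mul,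
        Matrix.transpose_sub, colProj_transpose, Matrix.transpose_one]
    calc Mᵀ * (Q b * Q a) * (A * M₀) = Mᵀ * Q b * (Q a * M) * h := by
          rw [hAM]; simp only [Matrix.mul_assoc]
      _ = (Matrix.of b)ᵀ * Nᵀ * ((1 - colProj M) * (1 - colProj M)) * N * Matrix.of a * h := by
        rw [h1, hQ]; simp only [Matrix.mul_assoc]
      _ = _ := by rw [one_sub_colProj_mul_self hM]; simp only [Matrix.mul_assoc]
  refine ⟨h, fun h0 => ?_, fun a b => ?_⟩
  -- Because `A` is isometric on the column space of `M₀`, `h` carries the Gram matrix of `M` to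
  -- that of `M₀`, so it is invertible.
  · have h1 : hᵀ * (Mᵀ * M) * h = 1 := by
      calc hᵀ * (Mᵀ * M) * h = (M * h)ᵀ * (M * h) := by
            rw [Matrix.transpose_mul]; simp only [Matrix.mul_assoc]
        _ = M₀ᵀ * (Aᵀ * A) * M₀ := by
          rw [← hAM, Matrix.transpose_mul]; simp only [Matrix.mul_assoc]
        _ = M₀ᵀ * M₀ * (M₀ᵀ * M₀) := by rw [hAA, hproj]; simp only [Matrix.mul_assoc]
        _ = 1 := by rw [hMM, Matrix.mul_one]
    have h2 := congrArg Matrix.det h1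
    rw [Matrix.det_mul, h0, mul_zero, Matrix.det_one] at h2
    exact zero_ne_one h2
  · have h1 := hQQ (Matrix.of.symm b) (Matrix.of.symm a)
    have h2 := hQQ (Matrix.of.symm a) (Matrix.of.symm b)
    have h3 := hPP (Matrix.of.symm b) (Matrix.of.symm a)
    have h4 := hPP (Matrix.of.symm a) (Matrix.of.symm b)
    have h5 := congrArg (fun X => Mᵀ * X * M₀) (hcomm (Matrix.of.symm b) (Matrix.of.symm a))
    simp only [Equiv.apply_symm_apply] at h1 h2 h3 h4
    simp only [Matrix.mul_sub, Matrix.sub_mul, Matrix.mul_assoc] at h1 h2 h3 h4 h5 ⊢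
    rw [h1, h2, h3, h4] at h5
    exact h5

theorem fromCols_mul_fromRows_one (h : Matrix (Fin 2 ⊕ Fin 2) (Fin 2 ⊕ Fin 2) ℝ) :
    fromCols (h * fromRows (1 : Matrix (Fin 2) (Fin 2) ℝ) (0 : Matrix (Fin 2) (Fin 2) ℝ))
      (h * fromRows (0 : Matrix (Fin 2) (Fin 2) ℝ) (1 : Matrix (Fin 2) (Fin 2) ℝ)) = h := by
  rw [← Matrix.mul_fromCols]
  convert Matrix.mul_one h
  ext (i | i) (j | j) <;> simp [Matrix.one_apply]

end Matrix

/-! ### Orthogonality detected on permuted frames -/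

/-- Evenness makes the permutation matrix an element of `SL4`. The two spare indices leave room to
correct the sign. -/
theorem exists_even_perm {i j : Fin 2 ⊕ Fin 2} (hij : i ≠ j) :
    ∃ σ : Equiv.Perm (Fin 2 ⊕ Fin 2),
      Equiv.Perm.sign σ = 1 ∧ σ (Sum.inl 0) = i ∧ σ (Sum.inl 1) = j := by
  have h : ∃ σ : Equiv.Perm (Fin 2 ⊕ Fin 2), σ (Sum.inl 0) = i ∧ σ (Sum.inl 1) = j := by
    refine ⟨Equiv.swap (Sum.inl 0) i * Equiv.swap (Sum.inl 1) (Equiv.swap (Sum.inl 0) i j), ?_⟩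
    revert i j
    decide
  obtain ⟨σ, h0, h1⟩ := h
  rcases Int.units_eq_one_or (Equiv.Perm.sign σ) with hs | hs
  · exact ⟨σ, hs, h0, h1⟩
  · refine ⟨σ * Equiv.swap (Sum.inr 0) (Sum.inr 1), ?_, ?_, ?_⟩
    · rw [Equiv.Perm.sign_mul, hs, Equiv.Perm.sign_swap (by simp)]
      rfl
    · rw [Equiv.Perm.mul_apply, Equiv.swap_apply_of_ne_of_ne (by simp) (by simp), h0]
    · rw [Equiv.Perm.mul_apply, Equiv.swap_apply_of_ne_of_ne (by simp) (by simp), h1]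

/-- A matrix is orthogonal if, in all positive orthonormal frames, the inverse of its Gram matrix has
identity upper left block. -/
theorem transpose_mul_self_eq_one_of_toBlocks₁₁ (g : SL4)
    (hg : ∀ k : SL4, k.1ᵀ * k.1 = 1 → (((g.1 * k.1)ᵀ * (g.1 * k.1))⁻¹).toBlocks₁₁ = 1) :
    g.1ᵀ * g.1 = 1 := by
  have key : ∀ i j, i ≠ j → (g.1ᵀ * g.1)⁻¹ i i = 1 ∧ (g.1ᵀ * g.1)⁻¹ i j = 0 := by
    intro i j hij
    obtain ⟨σ, hs, h0, h1⟩ := exists_even_perm hij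
    let k : SL4 := ⟨(1 : Matrix (Fin 2 ⊕ Fin 2) (Fin 2 ⊕ Fin 2) ℝ).submatrix id σ, by
      rw [Matrix.det_permute', hs]; simp⟩
    have hk : k.1ᵀ * k.1 = 1 := by
      simp only [k, Matrix.transpose_submatrix, Matrix.transpose_one]
      rw [← Matrix.submatrix_mul _ _ _ _ _ Function.bijective_id, Matrix.one_mul,
        Matrix.submatrix_one_equiv]
    have hgk : g.1 * k.1 = g.1.submatrix id σ := by
      ext a b
      simp [k, Matrix.mul_apply, Matrix.one_apply]
    have h2 := hg k hk
    rw [hgk, Matrix.transpose_submatrix,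
      ← Matrix.submatrix_mul _ _ _ _ _ Function.bijective_id, Matrix.inv_submatrix_equiv] at h2
    constructor
    · simpa [Matrix.toBlocks₁₁, h0] using congrFun (congrFun h2 0) 0
    · simpa [Matrix.toBlocks₁₁, h0, h1] using congrFun (congrFun h2 0) 1
  have h1 : (g.1ᵀ * g.1)⁻¹ = 1 := by
    ext i j
    by_cases hij : i = j
    · subst hij
      obtain ⟨j, hj⟩ := (by decide : ∀ i : Fin 2 ⊕ Fin 2, ∃ j, i ≠ j) i
      rw [(key i j hj).1, Matrix.one_apply_eq]
    · rw [(key i j hij).2, Matrix.one_apply_ne hij]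
  have hu : IsUnit (g.1ᵀ * g.1).det := by
    rw [Matrix.det_mul, Matrix.det_transpose, g.2]; simp
  rw [← Matrix.nonsing_inv_nonsing_inv _ hu, h1, inv_one]

/-! ### Gauge equivalences as operators on `ℝ⁴` -/

namespace Subbundle

variable {E E' : HRP1 → Submodule ℝ E4}

/-- The operator on `ℝ⁴` which is the isomorphism on the fibre of `E` and zero on its
complement. -/
noncomputable def Iso.extend (Φ : Iso E E') (p : HRP1) : E4 →L[ℝ] E4 :=
  (E' p).subtypeL ∘L ((Φ.fibre p).toContinuousLinearEquiv : E p →L[ℝ] E' p) ∘L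
    (E p).orthogonalProjectionOnto

theorem Iso.extend_apply (Φ : Iso E E') (p : HRP1) (w : E4) :
    Φ.extend p w = Φ.fibre p ((E p).orthogonalProjectionOnto w) := rfl

theorem Iso.contMDiff_extend (Φ : Iso E E') :
    ContMDiff 𝓘(ℝ, SplitCoord) 𝓘(ℝ, E4 →L[ℝ] E4) ∞ Φ.extend := Φ.smooth

theorem Iso.extend_mul_starProjection (Φ : Iso E E') (p : HRP1) :
    Φ.extend p * (E p).starProjection = Φ.extend p := by
  ext1 w
  change Φ.extend p ((E p).starProjection w) = _
  rw [extend_apply, extend_apply, Submodule.starProjection_apply,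
    Submodule.orthogonalProjectionOnto_mem_subspace_eq_self]

theorem Iso.starProjection_mul_extend (Φ : Iso E E') (p : HRP1) :
    (E' p).starProjection * Φ.extend p = Φ.extend p := by
  ext1 w
  exact Submodule.starProjection_eq_self_iff.2 (Subtype.prop _)

theorem Iso.star_extend_mul_extend (Φ : Iso E E') (p : HRP1) :
    star (Φ.extend p) * Φ.extend p = (E p).starProjection := by
  ext1 w
  refine ext_inner_left ℝ fun v => ?_
  change inner ℝ v (ContinuousLinearMap.adjoint (Φ.extend p) (Φ.extend p w)) = _
  rw [ContinuousLinearMap.adjoint_inner_right, extend_apply, extend_apply, ← Submodule.coe_inner,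
    LinearIsometryEquiv.inner_map_map, Submodule.coe_inner]
  change inner ℝ ((E p).starProjection v) ((E p).starProjection w) = _
  rw [Submodule.inner_starProjection_left_eq_right, Submodule.starProjection_apply (E p) w,
    Submodule.starProjection_mem_subspace_eq_self]

/-- It suffices to test the connection on projections of constant vectors `w`: for this section `s`,
`Φ s` is `Φ.extend` applied to `w`. -/
theorem Iso.starProjection_mul_fderiv_extend (Φ : Iso E E')
    (hE : ContMDiff 𝓘(ℝ, SplitCoord) 𝓘(ℝ, E4 →L[ℝ] E4) ∞ fun p => (E p).starProjection)
    (hΦ : ∀ s : ∀ p, E p, IsSmooth s → ∀ (p : HRP1) (v : TangentSpace 𝓘(ℝ, SplitCoord) p),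
      conn (fun q => Φ.fibre q (s q)) p v = Φ.fibre p (conn s p v))
    (k : SL4) (x a : SplitCoord) :
    (E' (param k (Matrix.of x))).starProjection *
        fderiv ℝ (fun x : SplitCoord => Φ.extend (param k (Matrix.of x))) x a =
      Φ.extend (param k (Matrix.of x)) *
        fderiv ℝ (fun x : SplitCoord => (E (param k (Matrix.of x))).starProjection) x a := by
  ext1 w
  have hw : ∀ {f : HRP1 → E4 →L[ℝ] E4}, ContMDiff 𝓘(ℝ, SplitCoord) 𝓘(ℝ, E4 →L[ℝ] E4) ∞ f →
      ContMDiff 𝓘(ℝ, SplitCoord) 𝓘(ℝ, E4) ∞ (fun p => f p w) ∧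
      fderiv ℝ (fun x : SplitCoord => f (param k (Matrix.of x))) x a w =
      fderiv ℝ (fun x : SplitCoord => f (param k (Matrix.of x)) w) x a := by
    intro f hf
    refine ⟨contMDiff_of_contDiff_param fun h => (contDiff_comp_param hf h).clm_apply
      contDiff_const, ?_⟩
    have h1 := (((contDiff_comp_param hf k).differentiable (by simp)) x).hasFDerivAt
    have h2 := (h1.clm_apply (hasFDerivAt_const w x)).fderiv
    simpa using (congrArg (fun L => L a) h2).symm
  let s : ∀ p, E p := fun p => (E p).orthogonalProjectionOnto w
  have hs : IsSmooth s := (hw hE).1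
  have h1 := congrArg Subtype.val (hΦ s hs (param k (Matrix.of x))
    (mfderiv 𝓘(ℝ, SplitCoord) 𝓘(ℝ, SplitCoord)
      (fun x : SplitCoord => param k (Matrix.of x)) x a))
  change (E' (param k (Matrix.of x))).starProjection
      (fderiv ℝ (fun x : SplitCoord => Φ.extend (param k (Matrix.of x))) x a w) =
    Φ.extend (param k (Matrix.of x))
      (fderiv ℝ (fun x : SplitCoord => (E (param k (Matrix.of x))).starProjection) x a w)
  rw [(hw hE).2, (hw Φ.contMDiff_extend).2, mfderiv_param (hw hE).1,
    mfderiv_param (hw Φ.contMDiff_extend).1]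
  exact h1

/-- A gauge equivalence intertwines the commutators of the derivatives of the projections. -/
theorem Iso.commutator_mul_extend (Φ : Iso E E')
    (hE : ContMDiff 𝓘(ℝ, SplitCoord) 𝓘(ℝ, E4 →L[ℝ] E4) ∞ fun p => (E p).starProjection)
    (hE' : ContMDiff 𝓘(ℝ, SplitCoord) 𝓘(ℝ, E4 →L[ℝ] E4) ∞ fun p => (E' p).starProjection)
    (hΦ : ∀ s : ∀ p, E p, IsSmooth s → ∀ (p : HRP1) (v : TangentSpace 𝓘(ℝ, SplitCoord) p),
      conn (fun q => Φ.fibre q (s q)) p v = Φ.fibre p (conn s p v))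
    (k : SL4) (x a b : SplitCoord) :
    (fderiv ℝ (fun x : SplitCoord => (E' (param k (Matrix.of x))).starProjection) x b *
      fderiv ℝ (fun x : SplitCoord => (E' (param k (Matrix.of x))).starProjection) x a -
      fderiv ℝ (fun x : SplitCoord => (E' (param k (Matrix.of x))).starProjection) x a *
      fderiv ℝ (fun x : SplitCoord => (E' (param k (Matrix.of x))).starProjection) x b) *
      Φ.extend (param k (Matrix.of x)) =
    Φ.extend (param k (Matrix.of x)) *
      (fderiv ℝ (fun x : SplitCoord => (E (param k (Matrix.of x))).starProjection) x b *
      fderiv ℝ (fun x : SplitCoord => (E (param k (Matrix.of x))).starProjection) x a -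
      fderiv ℝ (fun x : SplitCoord => (E (param k (Matrix.of x))).starProjection) x a *
      fderiv ℝ (fun x : SplitCoord => (E (param k (Matrix.of x))).starProjection) x b) := by
  have h2 : (2 : WithTop ℕ∞) ≤ ∞ := WithTop.coe_le_coe.2 (le_top : (2 : ℕ∞) ≤ ⊤)
  have hA := contDiff_comp_param Φ.contMDiff_extend k
  have hQ := contDiff_comp_param hE' k
  refine commutator_fderiv_mul_eq (A := fun x => Φ.extend (param k (Matrix.of x)))
    (hA.of_le h2) ((contDiff_comp_param hE k).of_le h2) (hQ.of_le h2) (fun x v => ?_) x a b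
  -- What remains is the product rule for `Q A = A`.
  rw [← Φ.starProjection_mul_fderiv_extend hE hΦ]
  have h3 : HasFDerivAt (fun x : SplitCoord => Φ.extend (param k (Matrix.of x))) _ x :=
    ((hA.differentiable (by simp)) x).hasFDerivAt
  have h4 : HasFDerivAt (fun x : SplitCoord => (E' (param k (Matrix.of x))).starProjection) _ x :=
    ((hQ.differentiable (by simp)) x).hasFDerivAt
  have h5 := h4.mul' h3
  have e : ((fun x : SplitCoord => (E' (param k (Matrix.of x))).starProjection) *
      fun x : SplitCoord => Φ.extend (param k (Matrix.of x))) =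
      fun x : SplitCoord => Φ.extend (param k (Matrix.of x)) :=
    funext fun x => Φ.starProjection_mul_extend _
  rw [e] at h5
  have h6 := congrArg (fun L => L v) (h3.unique h5)
  rw [add_comm]
  exact h6

end Subbundle

/-! ### Invariance forces orthogonality -/

open Subbundle

theorem mul_fromRows_zero (h : SL4) (a : SplitQuat) :
    h.1 * Matrix.fromRows a (0 : SplitQuat) =
      h.1 * Matrix.fromRows (1 : SplitQuat) (0 : SplitQuat) * a := by
  rw [Matrix.mul_assoc, Matrix.fromRows_mul, Matrix.one_mul, Matrix.zero_mul]

theorem transpose_mul_self_eq_one_of_fixes {g : SL4} (hg : FixesBasicAntiInstanton g) :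
    g.1ᵀ * g.1 = 1 := by
  obtain ⟨Φ, hΦ⟩ := hg
  refine transpose_mul_self_eq_one_of_toBlocks₁₁ g fun k hk => ?_
  have hM := det_frame_ne_zero (g * k) 0
  have hdet : ((g * k).1ᵀ * (g * k).1).det = 1 := by
    rw [Matrix.det_mul, Matrix.det_transpose, (g * k).2, mul_one]
  -- In blocks, orthogonality of `k` says that its two pairs of columns are orthonormal and mutually
  -- orthogonal.
  have hk' := hk
  rw [← Matrix.fromCols_mul_fromRows_one k.1, Matrix.transpose_fromCols,
    Matrix.fromRows_mul_fromCols, ← Matrix.fromBlocks_one, Matrix.fromBlocks_inj] at hk'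
  obtain ⟨hNN, -, hMN, hMM⟩ := hk'
  have hP : ∀ k : SL4, (universalBundle (param k (Matrix.of 0))).starProjection =
      toEuclideanCLM (n := Fin 2 ⊕ Fin 2) (𝕜 := ℝ)
        (colProj (k.1 * Matrix.fromRows (0 : SplitQuat) (1 : SplitQuat))) :=
    fun k => universalProj_param k 0
  -- The pull-back in the chart at `k` is the universal bundle in the chart at `g * k`, so the same
  -- derivative formula serves both projections.
  have hpull : ∀ x : SplitCoord, pullback g universalBundle (param k (Matrix.of x)) =
      universalBundle (param (g * k) (Matrix.of x)) :=
    fun x => congrArg universalBundle (smul_param g k _)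
  have hE' : ContMDiff 𝓘(ℝ, SplitCoord) 𝓘(ℝ, E4 →L[ℝ] E4) ∞
      fun p => (pullback g universalBundle p).starProjection :=
    contMDiff_universalProj.comp (contMDiff_smul g)
  have hcomm := Φ.commutator_mul_extend contMDiff_universalProj hE' hΦ k 0
  have h1 := Φ.extend_mul_starProjection (param k (Matrix.of 0))
  have h2 := Φ.starProjection_mul_extend (param k (Matrix.of 0))
  have h3 := Φ.star_extend_mul_extend (param k (Matrix.of 0))
  simp only [hpull] at hcomm
  rw [hP] at h1 h3
  rw [show pullback g universalBundle (param k (Matrix.of 0)) = _ from hpull 0, hP] at h2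
  obtain ⟨A, hA⟩ := EquivLike.surjective (toEuclideanCLM (n := Fin 2 ⊕ Fin 2) (𝕜 := ℝ))
    (Φ.extend (param k (Matrix.of 0)))
  have hinj := EquivLike.injective (toEuclideanCLM (n := Fin 2 ⊕ Fin 2) (𝕜 := ℝ))
  have hD : ∀ (k : SL4) (a : SplitCoord), fderiv ℝ
      (fun x : SplitCoord => (universalBundle (param k (Matrix.of x))).starProjection) 0 a =
      toEuclideanCLM (n := Fin 2 ⊕ Fin 2) (𝕜 := ℝ) (derivProj k a) :=
    fun k a => (StarAlgEquiv.apply_symm_apply _ _).symm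
  rw [← hA, ← map_mul] at h1 h2
  rw [← hA, ← map_star, ← map_mul, Matrix.star_eq_conjTranspose,
    Matrix.conjTranspose_eq_transpose_of_trivial] at h3
  simp only [hD, ← hA, ← map_mul, ← map_sub] at hcomm
  obtain ⟨h, hh, e⟩ := exists_curvature_eq
    (N := (g * k).1 * Matrix.fromRows (1 : SplitQuat) (0 : SplitQuat)) hMM hMN hNN hM
    (hinj h1) (hinj h2) (hinj h3) (derivProj_transpose k) (derivProj_transpose (g * k))
    (fun a => by rw [derivProj_mul, mul_fromRows_zero])
    (fun a => by rw [derivProj_mul, mul_fromRows_zero]) (fun a b => hinj (hcomm a b))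
  rw [← Matrix.fromCols_mul_fromRows_one (g * k).1] at hdet
  have h4 := gram_inv_toBlocks₁₁ hM hdet (schur_eq_one hM hdet hh e)
  rw [Matrix.fromCols_mul_fromRows_one] at h4
  exact h4

/-! ### Orthogonal matrices preserve the connection -/

/-- The linear isometry of `ℝ⁴` given by an orthogonal matrix. -/
noncomputable def orthogonalIsometry {g : SL4}
    (hg : g.1 ∈ Matrix.orthogonalGroup (Fin 2 ⊕ Fin 2) ℝ) :
    E4 ≃ₗᵢ[ℝ] E4 :=
  Unitary.linearIsometryEquiv ⟨toEuclideanCLM (n := Fin 2 ⊕ Fin 2) (𝕜 := ℝ) g.1,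
    Unitary.map_mem (toEuclideanCLM (n := Fin 2 ⊕ Fin 2) (𝕜 := ℝ)) hg⟩

theorem map_universalBundle {g : SL4}
    (hg : g.1 ∈ Matrix.orthogonalGroup (Fin 2 ⊕ Fin 2) ℝ) (p : HRP1) :
    (universalBundle p).map ((orthogonalIsometry hg).toLinearEquiv : E4 →ₗ[ℝ] E4) =
      pullback g universalBundle p := by
  induction p using Quotient.inductionOn with
  | _ u =>
    change (LinearMap.range (Matrix.toEuclideanLin u.1)).map _ =
      LinearMap.range (Matrix.toEuclideanLin (g.1 * u.1))
    rw [Matrix.toEuclideanLin, Matrix.toLpLin_mul (q := 2), LinearMap.range_comp]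
    rfl

theorem orthogonalIsometry_starProjection {g : SL4}
    (hg : g.1 ∈ Matrix.orthogonalGroup (Fin 2 ⊕ Fin 2) ℝ) (p : HRP1) (w : E4) :
    (pullback g universalBundle p).starProjection (orthogonalIsometry hg w) =
      orthogonalIsometry hg ((universalBundle p).starProjection w) := by
  simp only [← map_universalBundle hg]
  rw [Submodule.starProjection_map_apply, LinearIsometryEquiv.symm_apply_apply]

/-- The gauge equivalence is the restriction of one constant isometry `T` to the fibres; being
constant, `T` passes through the derivative, and being an isometry it intertwines the projections.
-/
theorem fixes_of_mem_orthogonalGroup {g : SL4}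
    (hg : g.1 ∈ Matrix.orthogonalGroup (Fin 2 ⊕ Fin 2) ℝ) : FixesBasicAntiInstanton g := by
  let G := orthogonalIsometry hg
  let T : E4 →L[ℝ] E4 := (G.toContinuousLinearEquiv : E4 →L[ℝ] E4)
  refine ⟨⟨fun p => (LinearIsometryEquiv.submoduleMap (universalBundle p) G).trans
    (LinearIsometryEquiv.ofEq _ _ (map_universalBundle hg p)), ?_⟩, fun s hs p v => ?_⟩
  · have hT : ContMDiff 𝓘(ℝ, SplitCoord) 𝓘(ℝ, E4 →L[ℝ] E4) ∞ fun p => T ∘L universalProj p :=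
      contMDiff_of_contDiff_param fun h =>
        contDiff_const.clm_comp (contDiff_comp_param contMDiff_universalProj h)
    refine hT.congr fun p => ?_
    ext1 w
    rfl
  · apply Subtype.ext
    have h1 : HasMFDerivAt 𝓘(ℝ, SplitCoord) 𝓘(ℝ, E4) (fun q => (s q : E4)) p _ :=
      ((hs p).mdifferentiableAt (by simp)).hasMFDerivAt
    have h2 := (T.hasMFDerivAt (x := (s p : E4))).comp p h1
    have h3 : mfderiv 𝓘(ℝ, SplitCoord) 𝓘(ℝ, E4) (fun q => T (s q : E4)) p v =
      T (mfderiv 𝓘(ℝ, SplitCoord) 𝓘(ℝ, E4) (fun q => (s q : E4)) p v) :=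
      congrArg (fun L => L v) h2.mfderiv
    change (pullback g universalBundle p).starProjection
      (mfderiv 𝓘(ℝ, SplitCoord) 𝓘(ℝ, E4) (fun q => T (s q : E4)) p v) =
      orthogonalIsometry hg ((universalBundle p).starProjection
        (mfderiv 𝓘(ℝ, SplitCoord) 𝓘(ℝ, E4) (fun q => (s q : E4)) p v))
    rw [h3]
    exact orthogonalIsometry_starProjection hg p _

theorem mainTheorem6 :
    {g : SL4 | FixesBasicAntiInstanton g} =
      {g : SL4 | (g : Matrix (Fin 2 ⊕ Fin 2) (Fin 2 ⊕ Fin 2) ℝ) ∈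
        Matrix.specialOrthogonalGroup (Fin 2 ⊕ Fin 2) ℝ} := by
  ext g
  rw [Set.mem_ofPred_eq, Set.mem_ofPred_eq, Matrix.mem_specialOrthogonalGroup_iff]
  refine ⟨fun hg => ⟨?_, g.2⟩, fun hg => fixes_of_mem_orthogonalGroup hg.1⟩
  rw [Matrix.mem_orthogonalGroup_iff']
  exact transpose_mul_self_eq_one_of_fixes hg
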